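/- Let $p\ge 3$ be a prime and let $i,j\ge 1$ be integers. Let $R(\mathbb Z_p;i,j,1,1)=\mathbb Z_p\langle x,y : x^iy+yx^j=1,\ y^2=0\rangle$ be the quotient of the free associative unital algebra on $x,y$ over the field $\mathbb Z_p$ with $p$ elements by the two-sided ideal generated by the two relations. Let $\nu_2:\mathbb Z\to\{0,1,2,\dots\}\cup\{\infty\}$ be the $2$-adic valuation, with $\nu_2(0)=\infty$; let $\gcd$ denote the non-negative greatest common divisor; and call an integer $a$ an odd multiple of $b$ if $a=kb$ for some odd integer $k$ (possibly negative). Then there is a nontrivial unital homomorphism $R(\mathbb Z_p;i,j,1,1)\to M_2(\mathbb Z_p)$ of $\mathbb Z_p$-algebras if and only if at least one of the following holds: (I) $\nu_2(j-i)>\nu_2(p-1)\ge\nu_2(i+j)$; (II) $\nu_2(j-i)=\nu_2(p-1)\ne\nu_2(i+j)$; (III) $\nu_2(j-i)<\nu_2(p-1)$ and $\gcd(j-i,p-1)$ is not an odd multiple of $\gcd(j+i,p-1)$; (IV) $\nu_2(j-i)<\nu_2(p-1)$, $p\mid i+j$ and $p\nmid i$; (V) $\nu_2(j-ip)<\nu_2(p+1)+\min(\nu_2(j-i),\nu_2(p-1))$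 and $j-i$ is not an odd multiple of $\gcd(j-ip,(p+1)(j-i),p^2-1)$. -/

import Mathlib

/-- The two defining relations `x ^ i * y ^ m + y ^ n * x ^ j = 1` and `y ^ (m + n) = 0` on the
free `A`-algebra on two generators `x = ι 0` and `y = ι 1`. -/
inductive MatRel (A : Type*) [CommRing A] (i j m n : ℕ) :
    FreeAlgebra A (Fin 2) → FreeAlgebra A (Fin 2) → Prop
  | unit : MatRel A i j m n
      (FreeAlgebra.ι A 0 ^ i * FreeAlgebra.ι A 1 ^ m
        + FreeAlgebra.ι A 1 ^ n * FreeAlgebra.ι A 0 ^ j) 1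
  | nilp : MatRel A i j m n (FreeAlgebra.ι A 1 ^ (m + n)) 0

/-- The `A`-algebra `R(A; i, j, m, n) = A⟨x, y : x^i y^m + y^n x^j = 1, y^(m+n) = 0⟩`: the quotient
of the free algebra `A⟨x, y⟩` by the two-sided ideal generated by the relations. -/
abbrev MatAlg (A : Type*) [CommRing A] (i j m n : ℕ) : Type _ :=
  RingQuot (MatRel A i j m n)

/-- The set `𝒜_A` of quadruples of positive integers `(i, j, m, n)` for which there is a
nontrivial (that is, nonzero) unital `A`-algebra homomorphism
`R(A; i, j, m, n) → M_{m+n}(A)`. -/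
def setA (A : Type*) [CommRing A] : Set (ℕ × ℕ × ℕ × ℕ) :=
  {q | ∃ i j m n : ℕ, q = (i, j, m, n) ∧ 0 < i ∧ 0 < j ∧ 0 < m ∧ 0 < n ∧
    ∃ f : MatAlg A i j m n →ₐ[A] Matrix (Fin (m + n)) (Fin (m + n)) A, ∃ r, f r ≠ 0}

/-- The 2-adic valuation on the integers, with `nu2 0 = ⊤`. -/
noncomputable def nu2 (a : ℤ) : ℕ∞ := emultiplicity 2 a

/-- `a` is an odd multiple of `b`. -/
def IsOddMultiple (a b : ℤ) : Prop := ∃ k : ℤ, Odd k ∧ a = k * b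

/-! A unital homomorphism to a matrix algebra is nonzero, so the question is whether 2×2 matrices X,
Y over F_p satisfy the two relations. By Cayley–Hamilton, X^n is a combination of X and 1 with Lucas
coefficients in t = tr X and d = det X. Since Y² = 0, the relations then reduce to `LucasBalanced t
d i j` (`exists_matrix_iff_exists_lucasBalanced`).

The roots a, b of T² - tT + d lie in F_{p²}. If a ≠ b, Binet's formula turns the condition into a^i
= -b^j, b^i = -a^j, a^i ≠ b^i. Distinct roots in F_p yield (I)-(III), a nonzero double root yields
(IV), and conjugate roots b = a^p yield (V).

In a cyclic unit group of order 2h, -1 has discrete logarithm h, so each case becomes a system of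
congruences mod 2h, with 2h = p - 1 or p² - 1. Solvability is a matter of 2-adic valuations and
gcds: `hasSplitExponents_iff_nu2`, `exists_half_exponent_iff_nu2`,
`exists_half_exponent_not_dvd_iff`. -/

/-- The Lucas sequence `u₀ = 0, u₁ = 1, uₙ₊₂ = t uₙ₊₁ - d uₙ`. -/
def lucasU {R : Type*} [CommRing R] (t d : R) : ℕ → R
  | 0 => 0
  | 1 => 1
  | n + 2 => t * lucasU t d (n + 1) - d * lucasU t d n

/-! ### Lucas sequences and powers of 2×2 matrices -/

section Lucas
variable {R S : Type*} [CommRing R] [CommRing S]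

theorem lucasU_map (f : R →+* S) (t d : R) (n : ℕ) :
    f (lucasU t d n) = lucasU (f t) (f d) n := by
  induction n using Nat.twoStepInduction with
  | zero => simp [lucasU]
  | one => simp [lucasU]
  | more n h1 h2 => simp [lucasU, h1, h2]

theorem lucasU_add_mul (a b : R) (n : ℕ) :
    (a - b) * lucasU (a + b) (a * b) n = a ^ n - b ^ n := by
  induction n using Nat.twoStepInduction with
  | zero => simp [lucasU]
  | one => simp [lucasU]
  | more n h1 h2 =>
    simp only [lucasU]
    linear_combination (a + b) * h2 - a * b * h1

theorem lucasU_double_succ (a : R) (n : ℕ) :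
    lucasU (a + a) (a * a) (n + 1) = (n + 1) * a ^ n := by
  induction n using Nat.twoStepInduction with
  | zero => simp [lucasU]
  | one => simp [lucasU]; ring
  | more n h1 h2 =>
    rw [lucasU, h1, h2]
    push_cast
    ring

theorem Matrix.sq_fin_two (X : Matrix (Fin 2) (Fin 2) R) :
    X * X = X.trace • X - X.det • (1 : Matrix (Fin 2) (Fin 2) R) := by
  ext a b
  fin_cases a <;> fin_cases b <;>
    simp [Matrix.mul_apply, Matrix.trace_fin_two, Matrix.det_fin_two, Fin.sum_univ_two] <;> ring

theorem Matrix.pow_fin_two (X : Matrix (Fin 2) (Fin 2) R) (n : ℕ) :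
    X ^ n = lucasU X.trace X.det n • X
      + (lucasU X.trace X.det (n + 1) - X.trace * lucasU X.trace X.det n) •
        (1 : Matrix (Fin 2) (Fin 2) R) := by
  induction n with
  | zero => simp [lucasU]
  | succ n ih =>
    rw [pow_succ, ih, add_mul, smul_mul_assoc, smul_mul_assoc, one_mul, Matrix.sq_fin_two,
      lucasU]
    module

end Lucas

/-- The Lucas sequence condition equivalent to the existence of a representation in which `x` has
trace `t` and determinant `d`. -/
def LucasBalanced {R : Type*} [CommRing R] (t d : R) (i j : ℕ) : Prop :=
  lucasU t d i = lucasU t d j ∧ lucasU t d i ≠ 0 ∧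
    lucasU t d (i + 1) + lucasU t d (j + 1) = t * lucasU t d i

theorem LucasBalanced.map_iff {R S : Type*} [CommRing R] [CommRing S] (f : R →+* S)
    (hf : Function.Injective f) (t d : R) (i j : ℕ) :
    LucasBalanced (f t) (f d) i j ↔ LucasBalanced t d i j := by
  simp only [LucasBalanced, ← lucasU_map, ← map_add, ← map_mul, hf.eq_iff, ne_eq,
    map_eq_zero_iff f hf]

/-! ### From matrices to roots of the characteristic polynomial -/

section Field
variable {F : Type*} [Field F]

theorem exists_matrix_iff_exists_lucasBalanced (i j : ℕ) :
    (∃ X Y : Matrix (Fin 2) (Fin 2) F, X ^ i * Y + Y * X ^ j = 1 ∧ Y ^ 2 = 0) ↔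
      ∃ t d : F, LucasBalanced t d i j := by
  constructor
  · rintro ⟨X, Y, h, hY⟩
    have htr : Y.trace = 0 :=
      (Matrix.isNilpotent_trace_of_isNilpotent ⟨2, hY⟩).eq_zero
    have hdet : Y.det = 0 := by
      have := congrArg Matrix.det hY
      simpa [Matrix.det_pow] using this
    have hYY : Y * Y = 0 := by rw [← sq, hY]
    -- Y has rank at most one, so Y X Y is a scalar multiple of Y.
    have hYXY : Y * X * Y = (X * Y).trace • Y := by
      rw [Matrix.trace_fin_two] at htr
      rw [Matrix.det_fin_two] at hdet
      have h11 : Y 1 1 = - Y 0 0 := by linear_combination htr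
      rw [h11] at hdet
      ext a b
      fin_cases a <;> fin_cases b <;>
        simp [Matrix.mul_apply, Matrix.trace_fin_two, Fin.sum_univ_two, h11]
      · linear_combination -X 1 1 * hdet
      · linear_combination X 0 1 * hdet
      · linear_combination X 1 0 * hdet
      · linear_combination -X 0 0 * hdet
    -- Polarised Cayley–Hamilton, with tr Y = 0.
    have hXY : X * Y + Y * X = X.trace • Y + (X * Y).trace • (1 : Matrix (Fin 2) (Fin 2) F) := by
      rw [Matrix.trace_fin_two] at htr
      have h11 : Y 1 1 = - Y 0 0 := by linear_combination htr
      ext a b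
      fin_cases a <;> fin_cases b <;>
        simp [Matrix.mul_apply, Matrix.trace_fin_two, Fin.sum_univ_two, h11] <;> ring
    have hY0 : Y ≠ 0 := by
      rintro rfl
      simp at h
    have hl (n : ℕ) : Y * X ^ n * Y = (lucasU X.trace X.det n * (X * Y).trace) • Y := by
      rw [Matrix.pow_fin_two, mul_add, add_mul, mul_smul_comm, smul_mul_assoc, hYXY,
        mul_smul_comm, smul_mul_assoc, mul_one, hYY, smul_zero, add_zero, smul_smul]
    have hone (n : ℕ) (hn : Y * X ^ n * Y = Y) : lucasU X.trace X.det n * (X * Y).trace = 1 := by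
      rw [hl] at hn
      exact smul_left_injective F hY0 (by simpa using hn)
    -- Multiplying the unit relation by Y on the left kills its second term; on the right, its
    -- first.
    have h1 := hone i (by
      have := congrArg (Y * ·) h
      simp only [mul_add, ← mul_assoc, hYY, zero_mul, add_zero, mul_one] at this
      exact this)
    have h2 := hone j (by
      have := congrArg (· * Y) h
      simp only [add_mul, mul_assoc, hYY, mul_zero, zero_add, one_mul] at this
      rw [mul_assoc]
      exact this)
    have hne : (X * Y).trace ≠ 0 := right_ne_zero_of_mul_eq_one h1
    have hij : lucasU X.trace X.det i = lucasU X.trace X.det j :=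
      mul_right_cancel₀ hne (h1.trans h2.symm)
    refine ⟨X.trace, X.det, hij, left_ne_zero_of_mul_eq_one h1, ?_⟩
    rw [Matrix.pow_fin_two X i, Matrix.pow_fin_two X j, ← hij] at h
    have h3 : (lucasU X.trace X.det (i + 1) + lucasU X.trace X.det (j + 1)
        - X.trace * lucasU X.trace X.det i) • Y = 0 := by
      have e : lucasU X.trace X.det i • (X * Y + Y * X) +
          (lucasU X.trace X.det (i + 1) + lucasU X.trace X.det (j + 1)
        - 2 * X.trace * lucasU X.trace X.det i) • Y = 1 := by
        rw [← h]
        simp only [add_mul, mul_add, smul_mul_assoc, mul_smul_comm, one_mul, mul_one]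
        module
      rw [hXY, smul_add, smul_smul _ (X * Y).trace, h1, one_smul] at e
      have e' := sub_eq_zero.2 e
      rw [← e']
      module
    exact sub_eq_zero.1 ((smul_eq_zero.1 h3).resolve_right hY0)
  · rintro ⟨t, d, h1, h2, h3⟩
    set u := lucasU t d i with hu
    have ht : (!![0, -d * u; u⁻¹, t] : Matrix (Fin 2) (Fin 2) F).trace = t := by
      simp [Matrix.trace_fin_two]
    have hd : (!![0, -d * u; u⁻¹, t] : Matrix (Fin 2) (Fin 2) F).det = d := by
      simp [Matrix.det_fin_two, h2]
    -- With Y = E₁₂, tr(XY) is the lower left entry of X, which must be u⁻¹; trace and determinant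
    -- fix the rest once the corner is 0.
    refine ⟨!![0, -d * u; u⁻¹, t], !![0, 1; 0, 0], ?_, ?_⟩
    · rw [Matrix.pow_fin_two _ i, Matrix.pow_fin_two _ j, ht, hd, ← h1, ← hu]
      ext a b
      fin_cases a <;> fin_cases b <;>
        simp [Matrix.mul_apply, Fin.sum_univ_two, Matrix.one_apply, Matrix.vecMul, dotProduct, h2]
      linear_combination h3
    · ext a b
      fin_cases a <;> fin_cases b <;> simp [sq, Matrix.mul_apply, Fin.sum_univ_two]

theorem lucasBalanced_add_mul_iff {a b : F} (hab : a ≠ b) (i j : ℕ) :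
    LucasBalanced (a + b) (a * b) i j ↔ a ^ i = -b ^ j ∧ b ^ i = -a ^ j ∧ a ^ i ≠ b ^ i := by
  have h0 : a - b ≠ 0 := sub_ne_zero.2 hab
  have hi := lucasU_add_mul a b i
  have hj := lucasU_add_mul a b j
  have hi1 := lucasU_add_mul a b (i + 1)
  have hj1 := lucasU_add_mul a b (j + 1)
  rw [pow_succ, pow_succ] at hi1 hj1
  constructor
  · rintro ⟨h1, h2, h3⟩
    have e1 : a ^ i - b ^ i = a ^ j - b ^ j := by rw [← hi, ← hj, h1]
    have e2 : a ^ i = -b ^ j := by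
      apply mul_left_cancel₀ h0
      linear_combination (a - b) * h3 - hi1 - hj1 + (a + b) * hi + a * e1
    refine ⟨e2, by linear_combination e2 - e1, fun h => ?_⟩
    rw [h, sub_self] at hi
    exact h2 ((mul_eq_zero.1 hi).resolve_left h0)
  · rintro ⟨h1, h2, h3⟩
    refine ⟨mul_left_cancel₀ h0 ?_, fun h => h3 ?_, mul_left_cancel₀ h0 ?_⟩
    · linear_combination hi - hj + h1 - h2
    · rw [h, mul_zero] at hi
      linear_combination -hi
    · linear_combination hi1 + hj1 - (a + b) * hi - b * h1 + a * h2

theorem lucasBalanced_double_iff {a : F} (i j : ℕ) (hi : 0 < i) (hj : 0 < j) :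
    LucasBalanced (a + a) (a * a) i j ↔
      (a = 0 ∧ i = 1 ∧ j = 1) ∨ (a ≠ 0 ∧ ((i + j : ℕ) : F) = 0 ∧ (i : F) ≠ 0 ∧ a ^ i = -a ^ j) := by
  obtain ⟨i, rfl⟩ := Nat.exists_eq_add_one.2 hi
  obtain ⟨j, rfl⟩ := Nat.exists_eq_add_one.2 hj
  simp only [LucasBalanced, lucasU_double_succ]
  by_cases ha : a = 0
  · subst ha
    rcases i with _ | i
    · rcases j with _ | j <;> simp
    · simp
  · have hai : a ^ i ≠ 0 := pow_ne_zero _ ha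
    simp only [ha, false_and, false_or, ne_eq, not_false_eq_true, true_and]
    push_cast
    constructor
    · rintro ⟨h1, h2, h3⟩
      have e : a ^ (i + 1) = -a ^ (j + 1) := by
        linear_combination h3 + a * h1
      refine ⟨?_, left_ne_zero_of_mul h2, e⟩
      apply mul_right_cancel₀ hai
      apply mul_right_cancel₀ ha
      rw [pow_succ, pow_succ] at e
      linear_combination a * h1 + (j + 1) * e
    · rintro ⟨h1, h2, h3⟩
      have e : a ^ i = - a ^ j := by
        apply mul_right_cancel₀ ha
        linear_combination h3
      refine ⟨?_, mul_ne_zero h2 hai, ?_⟩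
      · linear_combination (i + 1) * e - a ^ j * h1
      · linear_combination a * (j + 2) * e - a * a ^ i * h1
end Field

/-! ### Divisibility and 2-adic lemmas -/

theorem Int.not_two_pow_dvd_of_dvd_sub_half {h a : ℤ} {n : ℕ} (hn : 2 ^ n ∣ 2 * h)
    (hn' : ¬ 2 ^ (n + 1) ∣ 2 * h) (H : 2 * h ∣ a - h) : ¬ 2 ^ n ∣ a := fun ha => hn' <| by
  have h1 := dvd_sub ha (hn.trans H)
  rw [sub_sub_cancel] at h1
  rw [pow_succ, mul_comm]
  exact mul_dvd_mul_left 2 h1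

theorem exists_eq_two_pow_mul {a : ℤ} (ha : a ≠ 0) : ∃ n : ℕ, 2 ^ n ∣ a ∧ ¬ 2 ^ (n + 1) ∣ a := by
  have : FiniteMultiplicity 2 a := Int.finiteMultiplicity_iff.2 ⟨by decide, ha⟩
  exact ⟨multiplicity 2 a, pow_multiplicity_dvd 2 a,
    this.not_pow_dvd_of_multiplicity_lt (Nat.lt_succ_self _)⟩

theorem exists_pow_dvd_of_not_dvd {q a : ℤ} {k : ℕ} (h : ¬ q ^ k ∣ a) :
    ∃ r, r + 1 ≤ k ∧ q ^ r ∣ a ∧ ¬ q ^ (r + 1) ∣ a := by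
  induction k with
  | zero => simp at h
  | succ k ih =>
    by_cases hk : q ^ k ∣ a
    · exact ⟨k, le_rfl, hk, h⟩
    · obtain ⟨r, h1, h2⟩ := ih hk
      exact ⟨r, h1.trans (Nat.le_succ k), h2⟩

theorem Int.gcd_div_odd {a m : ℤ} {n : ℕ} (hn : 2 ^ n ∣ m) (ha : ¬ 2 ^ n ∣ a) :
    ∃ k l : ℤ, Odd k ∧ a = k * Int.gcd a m ∧ m = 2 * Int.gcd a m * l := by
  obtain ⟨k, hk⟩ := Int.gcd_dvd_left a m
  obtain ⟨l, hl⟩ := Int.gcd_dvd_right a m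
  obtain ⟨r, hr, hra, hra'⟩ := exists_pow_dvd_of_not_dvd ha
  have h1 : (2 : ℤ) ^ (r + 1) ∣ m := (pow_dvd_pow 2 hr).trans hn
  have hrg : (2 : ℤ) ^ r ∣ Int.gcd a m :=
    Int.dvd_coe_gcd hra ((pow_dvd_pow 2 (Nat.le_succ r)).trans h1)
  have hrg' : ¬ (2 : ℤ) ^ (r + 1) ∣ Int.gcd a m := fun h => hra' (h.trans (Int.gcd_dvd_left _ _))
  obtain ⟨w, hw⟩ := hrg
  have hwo : ¬ (2 : ℤ) ∣ w := fun h => hrg' (by rw [hw, pow_succ]; exact mul_dvd_mul_left _ h)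
  have h0 : (2 : ℤ) ^ r ≠ 0 := by positivity
  have hl2 : (2 : ℤ) ∣ l := by
    rw [hl, hw, pow_succ, mul_assoc] at h1
    exact (Int.prime_two.dvd_or_dvd (Int.dvd_of_mul_dvd_mul_left h0 h1)).resolve_left hwo
  refine ⟨k, l / 2, ?_, by rw [mul_comm]; exact hk, ?_⟩
  · rw [← Int.not_even_iff_odd, even_iff_two_dvd]
    intro h
    apply hra'
    rw [hk, hw, pow_succ, mul_assoc]
    exact mul_dvd_mul_left _ (h.mul_left w)
  · obtain ⟨l', rfl⟩ := hl2
    rw [Int.mul_ediv_cancel_left _ (by norm_num : (2 : ℤ) ≠ 0)]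
    linear_combination hl

theorem Int.exists_two_mul_dvd_sub_half_iff {h a : ℤ} {n : ℕ} (hn : 2 ^ n ∣ 2 * h)
    (hn' : ¬ 2 ^ (n + 1) ∣ 2 * h) : (∃ s : ℤ, 2 * h ∣ s * a - h) ↔ ¬ 2 ^ n ∣ a := by
  constructor
  · rintro ⟨s, hs⟩ ha
    exact Int.not_two_pow_dvd_of_dvd_sub_half hn hn' hs (ha.mul_left s)
  · intro ha
    obtain ⟨k, l, ⟨k, rfl⟩, hk', hl⟩ := Int.gcd_div_odd hn ha
    refine ⟨l, k, ?_⟩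
    have hl' : h = Int.gcd a (2 * h) * l := by linarith
    linear_combination l * hk' - (2 * k + 1) * hl'

/-- The witness is c = N / q^(r+1): then i * c is a multiple of N / q but not of N. -/
theorem exists_mul_dvd_of_pow_dvd {q i j N : ℤ} {r : ℕ} (hN : N ≠ 0) (h1 : q ^ r ∣ i)
    (h2 : ¬ q ^ (r + 1) ∣ i) (h3 : q ^ (r + 1) ∣ N) (h4 : q ^ (r + 1) ∣ i + j) :
    ∃ c, N ∣ (i + j) * c ∧ ¬ N ∣ i * c ∧ ∀ D, q * D ∣ N → D ∣ i * c := by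
  obtain ⟨i', rfl⟩ := h1
  obtain ⟨m, rfl⟩ := h3
  have hq : q ≠ 0 := by rintro rfl; simp at hN
  have hm : m ≠ 0 := right_ne_zero_of_mul hN
  refine ⟨m, mul_dvd_mul_right h4 m, fun h => h2 ?_, fun D hD => ?_⟩
  · exact Int.dvd_of_mul_dvd_mul_right hm h
  · have : D ∣ q ^ r * m := by
      apply Int.dvd_of_mul_dvd_mul_left hq
      rwa [← mul_assoc, ← pow_succ']
    exact this.trans ⟨i', by ring⟩

/-! ### Congruences for two distinct roots in the base field -/

/-- Discrete-logarithm form of the equations `α ^ i = -β ^ j`, `β ^ i = -α ^ j`, `α ^ i ≠ β ^ i`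
in a cyclic group of order `2 * h`. -/
def HasSplitExponents (h i j : ℤ) : Prop :=
  ∃ a b : ℤ, 2 * h ∣ a * i - (h + b * j) ∧ 2 * h ∣ b * i - (h + a * j) ∧ ¬ 2 * h ∣ a * i - b * i

/-- Put c = a - b; subtracting the two congruences eliminates h. -/
theorem hasSplitExponents_iff (h i j : ℤ) :
    HasSplitExponents h i j ↔ ∃ c b : ℤ, 2 * h ∣ (i + j) * c ∧
      2 * h ∣ b * (i - j) + i * c - h ∧ ¬ 2 * h ∣ i * c := by
  constructor
  · rintro ⟨a, b, h1, h2, h3⟩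
    refine ⟨a - b, b, ?_, ?_, ?_⟩
    · have := dvd_sub h1 h2
      rwa [show a * i - (h + b * j) - (b * i - (h + a * j)) = (i + j) * (a - b) by ring] at this
    · convert h1 using 1; ring
    · convert h3 using 3; ring
  · rintro ⟨c, b, h1, h2, h3⟩
    refine ⟨b + c, b, ?_, ?_, ?_⟩
    · convert h2 using 1; ring
    · have := dvd_sub h2 h1
      rwa [show b * (i - j) + i * c - h - (i + j) * c = b * i - (h + (b + c) * j) by ring] at this
    · convert h3 using 3; ring

theorem hasSplitExponents_iff_of_two_pow_dvd {h i j : ℤ} {n : ℕ} (hn : 2 ^ n ∣ 2 * h)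
    (hn' : ¬ 2 ^ (n + 1) ∣ 2 * h) (hji : 2 ^ n ∣ j - i) :
    HasSplitExponents h i j ↔ ¬ 2 ^ n ∣ i := by
  have hN : 2 * h ≠ 0 := fun h0 => hn' (by simp [h0])
  rw [hasSplitExponents_iff]
  constructor
  · rintro ⟨c, b, -, h2, -⟩ hi
    refine Int.not_two_pow_dvd_of_dvd_sub_half hn hn' h2 ?_
    rw [← neg_sub j i]
    exact dvd_add (hji.neg_right.mul_left b) (hi.mul_right c)
  · intro hi
    obtain ⟨r, hr, hri, hri'⟩ := exists_pow_dvd_of_not_dvd hi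
    have hij : (2 : ℤ) ^ (r + 1) ∣ i + j := by
      have : i + j = 2 * i + (j - i) := by ring
      rw [this, pow_succ']
      exact dvd_add (mul_dvd_mul_left 2 hri) (by rw [← pow_succ']; exact (pow_dvd_pow 2 hr).trans hji)
    obtain ⟨c, h1, h2, h3⟩ := exists_mul_dvd_of_pow_dvd hN hri hri' ((pow_dvd_pow 2 hr).trans hn) hij
    -- Here i * c is a multiple of h but not of 2h, hence congruent to h.
    refine ⟨c, 0, h1, ?_, h2⟩
    obtain ⟨t, ht⟩ := h3 h dvd_rfl
    rw [ht] at h2 ⊢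
    rcases Int.even_or_odd' t with ⟨s, rfl | rfl⟩
    · exact absurd ⟨s, by ring⟩ h2
    · exact ⟨s, by ring⟩

theorem not_two_mul_dvd_self {a : ℤ} (ha : a ≠ 0) : ¬ 2 * a ∣ a := by
  rintro ⟨k, hk⟩
  have : 1 = 2 * k := mul_left_cancel₀ ha (by linear_combination hk)
  lia

/-- Let Dm, Dp be the gcds of j - i, j + i with 2h. Since Dm divides h, a suitable b exists iff Dm ∣
i c, leaving a condition on c alone. If Dm is an odd multiple of Dp, then Dp ∣ i, so 2h ∣ (i + j) c
forces 2h ∣ i c. Otherwise some prime q admits c = 2h / q^(r+1), where q^r exactly divides i. -/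
theorem hasSplitExponents_iff_of_not_two_pow_dvd {h i j : ℤ} {n : ℕ} (hn : 2 ^ n ∣ 2 * h)
    (hn' : ¬ 2 ^ (n + 1) ∣ 2 * h) (hji : ¬ 2 ^ n ∣ j - i) :
    HasSplitExponents h i j ↔
      ¬ IsOddMultiple (Int.gcd (j - i) (2 * h)) (Int.gcd (j + i) (2 * h)) := by
  have hN : 2 * h ≠ 0 := fun h0 => hn' (by simp [h0])
  obtain ⟨k, l, hk, hjik, hNl⟩ := Int.gcd_div_odd hn hji
  obtain ⟨r, hr⟩ := Int.gcd_dvd_left (j + i) (2 * h)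
  have hpN := Int.gcd_dvd_right (j + i) (2 * h)
  have hmN := Int.gcd_dvd_right (j - i) (2 * h)
  have hpmax : ∀ z : ℤ, z ∣ j + i → z ∣ 2 * h → z ∣ Int.gcd (j + i) (2 * h) :=
    fun z h1 h2 => Int.dvd_coe_gcd h1 h2
  have hmmax : ∀ z : ℤ, z ∣ j - i → z ∣ 2 * h → z ∣ Int.gcd (j - i) (2 * h) :=
    fun z h1 h2 => Int.dvd_coe_gcd h1 h2
  have bp := Int.gcd_eq_gcd_ab (j + i) (2 * h)
  have bm := Int.gcd_eq_gcd_ab (j - i) (2 * h)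
  generalize Int.gcdA (j + i) (2 * h) = xp at bp
  generalize Int.gcdB (j + i) (2 * h) = yp at bp
  generalize Int.gcdA (j - i) (2 * h) = xm at bm
  generalize Int.gcdB (j - i) (2 * h) = ym at bm
  have hDp0 : (Int.gcd (j + i) (2 * h) : ℤ) ≠ 0 := by
    intro h0
    rw [h0, zero_dvd_iff] at hpN
    exact hN hpN
  have hro : (2 * Int.gcd (j + i) (2 * h) : ℤ) ∣ 2 * h → Odd r := by
    intro h2
    rw [← Int.not_even_iff_odd, even_iff_two_dvd]
    rintro ⟨r', rfl⟩
    exact not_two_mul_dvd_self hDp0 (hpmax _ ⟨r', by linear_combination hr⟩ h2)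
  generalize (Int.gcd (j + i) (2 * h) : ℤ) = Dp at *
  generalize (Int.gcd (j - i) (2 * h) : ℤ) = Dm at *
  rw [hasSplitExponents_iff]
  constructor
  · rintro ⟨c, b, h1, -, h3⟩ ⟨k', hk', rfl⟩
    obtain ⟨s, hs⟩ := (hro ⟨k' * l, by linear_combination hNl⟩).sub_odd (hk.mul hk')
    have hi : i = s * Dp := by
      have : 2 * i = 2 * (s * Dp) := by linear_combination hr - hjik + Dp * hs
      exact mul_left_cancel₀ two_ne_zero this
    obtain ⟨z, hz⟩ := h1
    apply h3
    rw [hi]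
    exact ⟨s * (xp * z + yp * c), by linear_combination s * c * bp + s * xp * hz⟩
  · intro hodd
    by_contra hno
    have key : ∀ c, 2 * h ∣ (i + j) * c → Dm ∣ i * c → 2 * h ∣ i * c := by
      intro c h1 ⟨z, hz⟩
      by_contra h2
      refine hno ⟨c, xm * (z - l), h1, ?_, h2⟩
      have hl' : h = Dm * l := by linarith
      exact ⟨ym * (z - l), by linear_combination (z - l) * bm + hz - hl'⟩
    have key2 : ∀ (q : ℤ) (r : ℕ), q ^ r ∣ i → ¬ q ^ (r + 1) ∣ i → q ^ (r + 1) ∣ 2 * h →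
        q ^ (r + 1) ∣ i + j → ¬ q * Dm ∣ 2 * h := by
      intro q r h1 h2 h3 h4 h5
      obtain ⟨c, c1, c2, c3⟩ := exists_mul_dvd_of_pow_dvd hN h1 h2 h3 h4
      exact c2 (key c c1 (c3 _ h5))
    -- A prime power dividing Dp but not Dm would contradict `key2` at that prime.
    have hdvd : Dp ∣ Dm := by
      rw [← Int.natAbs_dvd_natAbs, Nat.dvd_iff_prime_pow_dvd_dvd]
      intro q k hq hqk
      rw [← Int.natCast_dvd] at hqk ⊢
      push_cast at hqk ⊢
      by_contra hqm
      have hqN := hqk.trans hpN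
      have hqs : (q : ℤ) ^ k ∣ j + i := hqk.trans ⟨r, hr⟩
      have hqi : ¬ (q : ℤ) ^ k ∣ i := by
        intro hi
        refine hqm (hmmax _ ?_ hqN)
        have := dvd_sub hqs (hi.mul_left 2)
        rwa [show j + i - 2 * i = j - i by ring] at this
      obtain ⟨t, ht, ht1, ht2⟩ := exists_pow_dvd_of_not_dvd hqi
      have hpw := pow_dvd_pow (q : ℤ) ht
      refine key2 q t ht1 ht2 (hpw.trans hqN) (by rw [add_comm i j]; exact hpw.trans hqs) ?_
      obtain ⟨m, hm⟩ := hmN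
      have hqm' : (q : ℤ) ∣ m := by
        by_contra hqm'
        rw [hm] at hqN
        exact hqm ((Nat.prime_iff_prime_int.1 hq).pow_dvd_of_dvd_mul_right k hqm' hqN)
      obtain ⟨m', rfl⟩ := hqm'
      exact ⟨m', by linear_combination hm⟩
    obtain ⟨k', hk'⟩ := hdvd
    rcases Int.even_or_odd' k' with ⟨s, rfl | rfl⟩
    -- If Dm / Dp is even, i has 2-adic valuation exactly t - 1, where t is that of Dp; this
    -- contradicts `key2` at q = 2.
    · obtain ⟨t, ⟨w, rfl⟩, ht⟩ := exists_eq_two_pow_mul hDp0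
      have hro' : Odd (r - 2 * s * k) :=
        (hro ⟨2 * s * l, by rw [hNl, hk']; ring⟩).sub_even ((even_two_mul s).mul_right k)
      have h2i : 2 * i = 2 ^ t * (w * (r - 2 * s * k)) := by
        linear_combination hr - hjik - k * hk'
      have hw : Odd w := by
        rw [← Int.not_even_iff_odd, even_iff_two_dvd]
        intro h
        exact ht (by rw [pow_succ]; exact mul_dvd_mul_left _ h)
      obtain ⟨v, hv⟩ := hw.mul hro'
      rcases t with _ | t
      · lia
      have hi : i = 2 ^ t * (2 * v + 1) := by
        rw [hv, pow_succ'] at h2i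
        linarith
      have hd : (2 : ℤ) ^ (t + 1) ∣ 2 ^ (t + 1) * w := dvd_mul_right _ _
      refine key2 2 t ⟨_, hi⟩ ?_ (hd.trans hpN)
        (hd.trans ⟨r, by rw [add_comm i j]; exact hr⟩) ⟨l, hNl⟩
      rw [hi, pow_succ]
      intro h
      have := Int.dvd_of_mul_dvd_mul_left (by positivity) h
      lia
    · exact hodd ⟨2 * s + 1, odd_two_mul_add_one s, by rw [hk']; ring⟩

theorem hasSplitExponents_iff_nu2 {h i j : ℤ} (hh : 0 < h) :
    HasSplitExponents h i j ↔
      (nu2 (j - i) > nu2 (2 * h) ∧ nu2 (2 * h) ≥ nu2 (i + j)) ∨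
      (nu2 (j - i) = nu2 (2 * h) ∧ nu2 (2 * h) ≠ nu2 (i + j)) ∨
      (nu2 (j - i) < nu2 (2 * h) ∧
        ¬ IsOddMultiple (Int.gcd (j - i) (2 * h)) (Int.gcd (j + i) (2 * h))) := by
  obtain ⟨n, hn, hn'⟩ := exists_eq_two_pow_mul (show 2 * h ≠ 0 by positivity)
  have hnu : nu2 (2 * h) = n := emultiplicity_eq_coe.2 ⟨hn, hn'⟩
  have hlt (x : ℤ) : nu2 x < n ↔ ¬ 2 ^ n ∣ x := emultiplicity_lt_iff_not_dvd
  have hgt (x : ℤ) : (n : ℕ∞) < nu2 x ↔ 2 ^ (n + 1) ∣ x := by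
    rw [nu2, pow_dvd_iff_le_emultiplicity, Nat.cast_add_one, ENat.add_one_le_iff (ENat.natCast_ne_top n)]
  have heq (x : ℤ) : nu2 x = n ↔ 2 ^ n ∣ x ∧ ¬ 2 ^ (n + 1) ∣ x := emultiplicity_eq_coe
  rw [hnu, hlt, heq, gt_iff_lt, hgt, ge_iff_le, ← not_lt, hgt, ne_comm, Ne, heq]
  -- When 2^n ∣ j - i, the identity i + j = 2i + (j - i) translates 2^n ∣ i into a condition on i +
  -- j.
  by_cases hji : (2 : ℤ) ^ n ∣ j - i
  · rw [hasSplitExponents_iff_of_two_pow_dvd hn hn' hji]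
    have h2 : (2 : ℤ) ^ n ∣ i ↔ 2 ^ (n + 1) ∣ 2 * i := by
      rw [pow_succ']
      exact (mul_dvd_mul_iff_left (by norm_num)).symm
    simp only [hji, not_true_eq_false, false_and, or_false, true_and]
    by_cases h1 : (2 : ℤ) ^ (n + 1) ∣ j - i
    · simp only [h1, true_and, not_true_eq_false, false_and, or_false]
      rw [h2, show i + j = 2 * i + (j - i) by ring, dvd_add_left h1]
    · simp only [h1, false_and, not_false_eq_true, true_and, false_or, not_iff_not]
      have e : i + j = 2 * i + (j - i) := by ring
      constructor
      · intro hi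
        rw [e]
        exact ⟨dvd_add (hi.mul_left 2) hji, by rwa [dvd_add_right (h2.1 hi)]⟩
      · rintro ⟨⟨a, ha⟩, hb⟩
        obtain ⟨b, hb'⟩ := hji
        rw [hb', pow_succ] at h1
        rw [ha, pow_succ] at hb
        have ha2 : Odd a := by
          rw [← Int.not_even_iff_odd, even_iff_two_dvd]
          exact fun h => hb (mul_dvd_mul_left _ h)
        have hb2 : Odd b := by
          rw [← Int.not_even_iff_odd, even_iff_two_dvd]
          exact fun h => h1 (mul_dvd_mul_left _ h)
        obtain ⟨s, hs⟩ := ha2.sub_odd hb2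
        refine ⟨s, ?_⟩
        have : 2 * i = 2 * (2 ^ n * s) := by linear_combination ha - hb' + 2 ^ n * hs
        exact mul_left_cancel₀ two_ne_zero this
  · rw [hasSplitExponents_iff_of_not_two_pow_dvd hn hn' hji]
    have h1 : ¬ (2 : ℤ) ^ (n + 1) ∣ j - i := fun h => hji ((pow_dvd_pow 2 (Nat.le_succ n)).trans h)
    simp [hji, h1]

theorem exists_half_exponent_iff_nu2 {h a : ℤ} (hh : 0 < h) :
    (∃ s : ℤ, 2 * h ∣ s * a - h) ↔ nu2 a < nu2 (2 * h) := by
  obtain ⟨n, hn, hn'⟩ := exists_eq_two_pow_mul (show 2 * h ≠ 0 by positivity)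
  rw [Int.exists_two_mul_dvd_sub_half_iff hn hn',
    show nu2 (2 * h) = n from emultiplicity_eq_coe.2 ⟨hn, hn'⟩]
  exact emultiplicity_lt_iff_not_dvd.symm

/-- If s L ≡ h mod 2h, then s times the gcd g is an odd multiple of h, and 2h ∣ s z iff s (L + z) ≡
h. An odd multiple L + z of g always satisfies the latter; otherwise s = h / g violates it. -/
theorem exists_half_exponent_not_dvd_iff {h L z : ℤ} (hh : 0 < h) :
    (∃ s : ℤ, 2 * h ∣ s * L - h ∧ ¬ 2 * h ∣ s * z) ↔
      nu2 L < nu2 (2 * h) ∧ ¬ IsOddMultiple (L + z) (Int.gcd L (2 * h)) := by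
  have bez := Int.gcd_eq_gcd_ab L (2 * h)
  generalize Int.gcdA L (2 * h) = x at bez
  generalize Int.gcdB L (2 * h) = y at bez
  constructor
  · rintro ⟨s, h1, h2⟩
    refine ⟨(exists_half_exponent_iff_nu2 hh).1 ⟨s, h1⟩, ?_⟩
    rintro ⟨k, hk, hk'⟩
    obtain ⟨e, he⟩ := Int.gcd_dvd_left L (2 * h)
    generalize (Int.gcd L (2 * h) : ℤ) = g at *
    obtain ⟨w, hw⟩ := h1
    have hsg : s * g = h * (x + 2 * (x * w + y * s)) := by
      linear_combination s * bez + x * hw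
    have hodd : Odd (e * (x + 2 * (x * w + y * s))) := by
      refine ⟨w, mul_left_cancel₀ hh.ne' ?_⟩
      linear_combination hw - s * he - e * hsg
    obtain ⟨v, hv⟩ := hk.mul (Int.odd_mul.1 hodd).2
    apply h2
    exact ⟨v - w, by linear_combination s * hk' + k * hsg + h * hv - hw⟩
  · rintro ⟨h1, h2⟩
    obtain ⟨n, hn, hn'⟩ := exists_eq_two_pow_mul (show 2 * h ≠ 0 by positivity)
    rw [← exists_half_exponent_iff_nu2 hh, Int.exists_two_mul_dvd_sub_half_iff hn hn'] at h1
    obtain ⟨k, l, ⟨k, rfl⟩, hk', hl⟩ := Int.gcd_div_odd hn h1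
    generalize (Int.gcd L (2 * h) : ℤ) = g at *
    have hl' : h = g * l := by linarith
    have hl0 : l ≠ 0 := by rintro rfl; simp at hl'; exact hh.ne' hl'
    refine ⟨l, ⟨k, by linear_combination l * hk' - (2 * k + 1) * hl'⟩, ?_⟩
    rintro ⟨v, hv⟩
    refine h2 ⟨2 * (k + v) + 1, odd_two_mul_add_one _, ?_⟩
    apply mul_left_cancel₀ hl0
    linear_combination hv + l * hk' + 2 * v * hl'

/-! ### Discrete logarithms and the three root types over F_p -/

theorem FiniteField.exists_zpow_generator (F : Type*) [Field F] [Finite F] {h : ℕ} (hh : 0 < h)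
    (hc : Nat.card F = 2 * h + 1) : ∃ g : F, g ≠ 0 ∧ (∀ x : F, x ≠ 0 → ∃ a : ℤ, x = g ^ a) ∧
      (∀ a b : ℤ, g ^ a = g ^ b ↔ 2 * (h : ℤ) ∣ a - b) ∧ g ^ (h : ℤ) = -1 := by
  obtain ⟨g, hg⟩ := IsCyclic.exists_generator (α := Fˣ)
  have ho : orderOf g = 2 * h := by
    rw [orderOf_eq_card_of_forall_mem_zpowers hg, Nat.card_units, hc, Nat.add_sub_cancel]
  have hz : ∀ a b : ℤ, (g : F) ^ a = g ^ b ↔ 2 * (h : ℤ) ∣ a - b := by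
    intro a b
    rw [show 2 * (h : ℤ) = (orderOf g : ℕ) by rw [ho]; push_cast; rfl,
      orderOf_dvd_sub_iff_zpow_eq_zpow, Units.ext_iff]
    push_cast
    rfl
  refine ⟨g, g.ne_zero, fun x hx => ?_, hz, ?_⟩
  · obtain ⟨a, ha⟩ := hg (Units.mk0 x hx)
    refine ⟨a, ?_⟩
    have := congrArg Units.val ha
    simpa using this.symm
  · have h1 : (g : F) ^ (h : ℤ) * g ^ (h : ℤ) = 1 := by
      rw [← zpow_add₀ g.ne_zero, ← zpow_zero (g : F), hz]
      exact ⟨1, by ring⟩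
    refine (mul_self_eq_one_iff.1 h1).resolve_left fun h2 => ?_
    rw [← zpow_zero (g : F), hz] at h2
    have := Int.le_of_dvd (by lia) h2
    lia

section PrimeField
variable {p : ℕ} [hp : Fact p.Prime] {K : Type*} [Field K] [CharP K p]

theorem pow_eq_self_iff_mem_range_castHom {x : K} :
    x ^ p = x ↔ ∃ a : ZMod p, ZMod.castHom dvd_rfl K a = x := by
  rw [← Subfield.mem_bot_iff_pow_eq_self K p, ← ZMod.fieldRange_castHom_eq_bot p,
    RingHom.mem_fieldRange]

/-- Euler's criterion: (p² - 1)/2 is a multiple of p - 1. Applied to the discriminant, it puts the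
roots in K. -/
theorem isSquare_castHom_of_card_eq_sq (hp2 : p ≠ 2) [Finite K] (hK : Nat.card K = p ^ 2)
    (a : ZMod p) : IsSquare (ZMod.castHom dvd_rfl K a) := by
  have := Fintype.ofFinite K
  by_cases ha : a = 0
  · simp [ha]
  have hchar : ringChar K ≠ 2 := by rwa [ringChar.eq K p]
  rw [FiniteField.isSquare_iff hchar ((map_ne_zero _).2 ha), ← Nat.card_eq_fintype_card, hK]
  obtain ⟨m, hm⟩ := hp.out.odd_of_ne_two hp2
  have : p ^ 2 / 2 = (p - 1) * (m + 1) := by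
    have : p ^ 2 = 2 * ((p - 1) * (m + 1)) + 1 := by
      rw [hm, Nat.add_sub_cancel]; ring
    lia
  rw [this, ← map_pow, pow_mul, ZMod.pow_card_sub_one_eq_one ha, one_pow, map_one]

theorem exists_lucasBalanced_zmod_iff (hp2 : p ≠ 2) [Finite K] (hK : Nat.card K = p ^ 2)
    {i j : ℕ} (hi : 0 < i) (hj : 0 < j) :
    (∃ t d : ZMod p, LucasBalanced t d i j) ↔
      (∃ a b : ZMod p, a ^ i = -b ^ j ∧ b ^ i = -a ^ j ∧ a ^ i ≠ b ^ i) ∨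
      (∃ a : ZMod p, a ≠ 0 ∧ ((i + j : ℕ) : ZMod p) = 0 ∧ (i : ZMod p) ≠ 0 ∧ a ^ i = -a ^ j) ∨
      (∃ a : K, a ^ i = -(a ^ p) ^ j ∧ (a ^ p) ^ i = -a ^ j ∧ a ^ i ≠ (a ^ p) ^ i) := by
  set f := ZMod.castHom (dvd_refl p) K
  have hf : Function.Injective f := f.injective
  have hring : ringChar K ≠ 2 := by rwa [ringChar.eq K p]
  have hring' : ringChar (ZMod p) ≠ 2 := by rwa [ringChar.eq (ZMod p) p]
  have h2 : (2 : K) ≠ 0 := Ring.two_ne_zero hring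
  have hfp (a : ZMod p) : f a ^ p = f a := pow_eq_self_iff_mem_range_castHom.2 ⟨a, rfl⟩
  constructor
  · rintro ⟨t, d, h⟩
    obtain ⟨δ, hδ⟩ := isSquare_castHom_of_card_eq_sq (K := K) hp2 hK (t ^ 2 - 4 * d)
    change f _ = _ at hδ
    simp only [map_sub, map_mul, map_pow, map_ofNat] at hδ
    obtain ⟨α, hα2⟩ : ∃ α, 2 * α = f t + δ := ⟨(f t + δ) / 2, by field_simp⟩
    have hroot : α * (f t - α) = f d := by
      apply mul_left_cancel₀ h2
      apply mul_left_cancel₀ h2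
      linear_combination (2 * f t - 2 * α - f t - δ) * hα2 + hδ
    by_cases hαp : α ^ p = α
    · obtain ⟨a, ha⟩ := pow_eq_self_iff_mem_range_castHom.1 hαp
      change f a = α at ha
      obtain ⟨b, rfl⟩ : ∃ b, t = a + b := ⟨t - a, by ring⟩
      obtain rfl : d = a * b := hf (by rw [← hroot, ← ha]; simp)
      by_cases hab : a = b
      · subst hab
        rcases (lucasBalanced_double_iff i j hi hj).1 h with ⟨rfl, rfl, rfl⟩ | h
        · left
          -- A double root 0 forces i = j = 1, which the distinct roots 1, -1 also realise.
          refine ⟨1, -1, by simp, by simp, ?_⟩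
          rw [pow_one, pow_one]
          exact (Ring.neg_one_ne_one_of_char_ne_two hring').symm
        · exact Or.inr (Or.inl ⟨a, h⟩)
      · exact Or.inl ⟨a, b, (lucasBalanced_add_mul_iff hab i j).1 h⟩
    · right; right
      have hfr : α ^ p * (f t - α ^ p) = f d := by
        have := congrArg (frobenius K p) hroot
        simpa [frobenius_def, hfp, map_mul, map_sub, mul_pow, sub_pow_char] using this
      -- Frobenius fixes t and d, so it sends α to the other root.
      have hβ : f t - α = α ^ p := by
        have : (α ^ p - α) * (f t - α - α ^ p) = 0 := by
          linear_combination hfr - hroot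
        exact sub_eq_zero.1 ((mul_eq_zero.1 this).resolve_left (sub_ne_zero.2 hαp))
      refine ⟨α, (lucasBalanced_add_mul_iff (Ne.symm hαp) i j).1 ?_⟩
      rw [← LucasBalanced.map_iff f hf] at h
      rwa [← hβ, hroot, add_sub_cancel]
  · rintro (⟨a, b, h⟩ | ⟨a, h⟩ | ⟨a, h⟩)
    · have hab : a ≠ b := by rintro rfl; exact h.2.2 rfl
      exact ⟨_, _, (lucasBalanced_add_mul_iff hab i j).2 h⟩
    · exact ⟨_, _, (lucasBalanced_double_iff i j hi hj).2 (Or.inr h)⟩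
    · have hab : a ≠ a ^ p := by intro e; exact h.2.2 (by rw [← e])
      have happ : (a ^ p) ^ p = a := by
        have := Fintype.ofFinite K
        rw [← pow_mul, ← sq, ← hK, Nat.card_eq_fintype_card, FiniteField.pow_card]
      obtain ⟨t, ht⟩ := pow_eq_self_iff_mem_range_castHom.1
        (show (a + a ^ p) ^ p = a + a ^ p by rw [add_pow_char, happ, add_comm])
      obtain ⟨d, hd⟩ := pow_eq_self_iff_mem_range_castHom.1
        (show (a * a ^ p) ^ p = a * a ^ p by rw [mul_pow, happ, mul_comm])
      refine ⟨t, d, (LucasBalanced.map_iff f hf t d i j).1 ?_⟩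
      change f t = _ at ht
      change f d = _ at hd
      rw [ht, hd]
      exact (lucasBalanced_add_mul_iff hab i j).2 h
end PrimeField

/-! ### Homomorphisms as matrix pairs -/

theorem mem_setA_one_one_iff {F : Type*} [Field F] {i j : ℕ} (hi : 0 < i) (hj : 0 < j) :
    (i, j, 1, 1) ∈ setA F ↔
      ∃ X Y : Matrix (Fin 2) (Fin 2) F, X ^ i * Y + Y * X ^ j = 1 ∧ Y ^ 2 = 0 := by
  constructor
  · rintro ⟨i', j', m, n, he, -, -, -, -, f, -⟩
    simp only [Prod.mk.injEq] at he
    obtain ⟨rfl, rfl, rfl, rfl⟩ := he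
    let φ := f.comp (RingQuot.mkAlgHom F (MatRel F i j 1 1))
    have hφ {x y} (h : MatRel F i j 1 1 x y) : φ x = φ y :=
      congrArg f (RingQuot.mkAlgHom_rel F h)
    refine ⟨φ (FreeAlgebra.ι F 0), φ (FreeAlgebra.ι F 1), ?_, ?_⟩
    · simpa only [map_add, map_mul, map_pow, map_one, pow_one] using hφ MatRel.unit
    · simpa only [map_pow, map_zero] using hφ MatRel.nilp
  · rintro ⟨X, Y, h1, h2⟩
    let φ : FreeAlgebra F (Fin 2) →ₐ[F] Matrix (Fin (1 + 1)) (Fin (1 + 1)) F :=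
      FreeAlgebra.lift F ![X, Y]
    have hφ : ∀ ⦃x y⦄, MatRel F i j 1 1 x y → φ x = φ y := by
      rintro _ _ (_ | _)
      · simpa [φ] using h1
      · simpa [φ] using h2
    refine ⟨i, j, 1, 1, rfl, hi, hj, one_pos, one_pos, RingQuot.liftAlgHom F ⟨φ, hφ⟩, 1, ?_⟩
    rw [map_one]
    exact one_ne_zero

theorem pow_eq_neg_pow_iff_of_zpow {F : Type*} [Field F] {g : F} {h : ℤ} (hg : g ≠ 0)
    (hz : ∀ a b : ℤ, g ^ a = g ^ b ↔ 2 * h ∣ a - b) (hneg : g ^ h = -1) (a b : ℤ) (i j : ℕ) :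
    (g ^ a) ^ i = -(g ^ b) ^ j ↔ 2 * h ∣ a * i - (h + b * j) := by
  rw [← hz, zpow_add₀ hg, hneg, zpow_mul, zpow_mul, zpow_natCast, zpow_natCast, neg_one_mul]

theorem pow_eq_pow_iff_of_zpow {F : Type*} [Field F] {g : F} {h : ℤ}
    (hz : ∀ a b : ℤ, g ^ a = g ^ b ↔ 2 * h ∣ a - b) (a b : ℤ) (i j : ℕ) :
    (g ^ a) ^ i = (g ^ b) ^ j ↔ 2 * h ∣ a * i - b * j := by
  rw [← hz, zpow_mul, zpow_mul, zpow_natCast, zpow_natCast]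

/-! ### Translation of the root conditions into exponents -/

section FiniteField
variable {F : Type*} [Field F] [Finite F] {h : ℕ}

theorem exists_pow_eq_neg_pow_pair_iff (hh : 0 < h) (hc : Nat.card F = 2 * h + 1) {i j : ℕ}
    (hi : 0 < i) (hj : 0 < j) :
    (∃ a b : F, a ^ i = -b ^ j ∧ b ^ i = -a ^ j ∧ a ^ i ≠ b ^ i) ↔ HasSplitExponents h i j := by
  obtain ⟨g, hg, hgen, hz, hneg⟩ := FiniteField.exists_zpow_generator F hh hc
  constructor
  · rintro ⟨a, b, h1, h2, h3⟩
    have ha : a ≠ 0 := by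
      rintro rfl
      rw [zero_pow hi.ne', zero_eq_neg] at h1
      rw [pow_eq_zero_iff hj.ne'] at h1
      exact h3 (by rw [h1])
    have hb : b ≠ 0 := by
      rintro rfl
      rw [zero_pow hj.ne', neg_zero, pow_eq_zero_iff hi.ne'] at h1
      exact ha h1
    obtain ⟨a, rfl⟩ := hgen a ha
    obtain ⟨b, rfl⟩ := hgen b hb
    rw [pow_eq_neg_pow_iff_of_zpow hg hz hneg] at h1 h2
    rw [Ne, pow_eq_pow_iff_of_zpow hz] at h3
    exact ⟨a, b, h1, h2, h3⟩
  · rintro ⟨a, b, h1, h2, h3⟩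
    refine ⟨g ^ a, g ^ b, ?_⟩
    rw [pow_eq_neg_pow_iff_of_zpow hg hz hneg, pow_eq_neg_pow_iff_of_zpow hg hz hneg, Ne,
      pow_eq_pow_iff_of_zpow hz]
    exact ⟨h1, h2, h3⟩

theorem exists_ne_zero_pow_eq_neg_pow_iff (hh : 0 < h) (hc : Nat.card F = 2 * h + 1) (i j : ℕ) :
    (∃ a : F, a ≠ 0 ∧ a ^ i = -a ^ j) ↔ nu2 ((j : ℤ) - i) < nu2 (2 * h) := by
  obtain ⟨g, hg, hgen, hz, hneg⟩ := FiniteField.exists_zpow_generator F hh hc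
  rw [← exists_half_exponent_iff_nu2 (by exact_mod_cast hh)]
  constructor
  · rintro ⟨a, ha, h1⟩
    obtain ⟨a, rfl⟩ := hgen a ha
    rw [pow_eq_neg_pow_iff_of_zpow hg hz hneg] at h1
    obtain ⟨k, hk⟩ := h1
    exact ⟨-a, k, by linear_combination hk⟩
  · rintro ⟨s, k, hk⟩
    refine ⟨g ^ (-s), zpow_ne_zero _ hg, ?_⟩
    rw [pow_eq_neg_pow_iff_of_zpow hg hz hneg]
    exact ⟨k, by linear_combination hk⟩

theorem exists_pow_eq_neg_conj_pow_iff (hh : 0 < h) {p : ℕ} (hp : Odd p)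
    (hph : p ^ 2 = 2 * h + 1) (hc : Nat.card F = 2 * h + 1) (i j : ℕ) :
    (∃ a : F, a ^ i = -(a ^ p) ^ j ∧ (a ^ p) ^ i = -a ^ j ∧ a ^ i ≠ (a ^ p) ^ i) ↔
      nu2 ((j : ℤ) - i * p) < nu2 (2 * h) ∧
        ¬ IsOddMultiple ((j : ℤ) - i) (Int.gcd ((j : ℤ) - i * p) (2 * h)) := by
  obtain ⟨g, hg, hgen, hz, hneg⟩ := FiniteField.exists_zpow_generator F hh hc
  have key := exists_half_exponent_not_dvd_iff (h := h) (L := (j : ℤ) - i * p)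
    (z := (p - 1) * i) (by exact_mod_cast hh)
  rw [show (j : ℤ) - i * p + (p - 1) * i = j - i by ring] at key
  rw [← key]
  obtain ⟨m, hm⟩ := hp
  zify at hph hm
  have e1 (a : ℤ) : (g ^ a) ^ p = g ^ (a * p) := by rw [zpow_mul, zpow_natCast]
  constructor
  · rintro ⟨a, -, h2, h3⟩
    have ha : a ≠ 0 := by
      rintro rfl
      apply h3
      rw [zero_pow (show p ≠ 0 by lia)]
    obtain ⟨a, rfl⟩ := hgen a ha
    rw [e1, pow_eq_neg_pow_iff_of_zpow hg hz hneg] at h2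
    rw [e1, Ne, pow_eq_pow_iff_of_zpow hz] at h3
    obtain ⟨k, hk⟩ := h2
    refine ⟨a, ⟨-k - 1, by linear_combination -hk⟩, ?_⟩
    rintro ⟨v, hv⟩
    exact h3 ⟨-v, by linear_combination -hv⟩
  · rintro ⟨s, ⟨k, hk⟩, h2⟩
    refine ⟨g ^ s, ?_⟩
    rw [e1, pow_eq_neg_pow_iff_of_zpow hg hz hneg, pow_eq_neg_pow_iff_of_zpow hg hz hneg, Ne,
      pow_eq_pow_iff_of_zpow hz]
    -- The first equation is the p-th power of the second: p h ≡ h as p is odd, and p² ≡ 1 mod 2h.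
    refine ⟨⟨-p * k - m - 1 - i * s, ?_⟩, ⟨-k - 1, by linear_combination -hk⟩, ?_⟩
    · linear_combination -p * hk - h * hm - i * s * hph
    · rintro ⟨v, hv⟩
      exact h2 ⟨-v, by linear_combination -hv⟩
end FiniteField

/-! ### Simplification of (V) and assembly -/

theorem nu2_mul (a b : ℤ) : nu2 (a * b) = nu2 a + nu2 b :=
  emultiplicity_mul Int.prime_two

/-- The identity (p+1)(j-i) = (p+1)(j-ip) + i(p²-1), with p + 1 even, makes the bound from
(p+1)(j-i) automatic. It also makes that entry redundant in the gcd of (V). -/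
theorem nu2_lt_add_min_iff {p : ℤ} (hp : Odd p) (i j : ℤ) :
    nu2 (j - i * p) < nu2 (p + 1) + min (nu2 (j - i)) (nu2 (p - 1)) ↔
      nu2 (j - i * p) < nu2 (p ^ 2 - 1) := by
  rw [← min_add_add_left, ← nu2_mul, ← nu2_mul, lt_min_iff,
    show (p + 1) * (p - 1) = p ^ 2 - 1 by ring, and_iff_right_iff_imp]
  intro hlt
  obtain ⟨n, hn⟩ := ENat.ne_top_iff_exists.1 hlt.ne_top
  rw [← hn] at hlt ⊢
  have hgt (x : ℤ) : (n : ℕ∞) < nu2 x ↔ 2 ^ (n + 1) ∣ x := by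
    rw [nu2, pow_dvd_iff_le_emultiplicity, Nat.cast_add_one,
      ENat.add_one_le_iff (ENat.natCast_ne_top n)]
  have hL : (2 : ℤ) ^ n ∣ j - i * p :=
    pow_dvd_iff_le_emultiplicity.2 hn.le
  rw [hgt] at hlt ⊢
  rw [show (p + 1) * (j - i) = (p + 1) * (j - i * p) + i * (p ^ 2 - 1) by ring, pow_succ']
  exact dvd_add (mul_dvd_mul hp.add_one.two_dvd hL) ((by rwa [← pow_succ'] : _ ∣ _).mul_left i)

theorem gcd_gcd_eq (p i j : ℤ) :
    Int.gcd (Int.gcd (j - i * p) ((p + 1) * (j - i))) (p ^ 2 - 1) =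
      Int.gcd (j - i * p) (p ^ 2 - 1) := by
  have h1 := Int.gcd_dvd_left (j - i * p) ((p + 1) * (j - i))
  apply Nat.dvd_antisymm <;> rw [← Int.natCast_dvd_natCast]
  · exact Int.dvd_coe_gcd ((Int.gcd_dvd_left _ _).trans h1) (Int.gcd_dvd_right _ _)
  · have hl := Int.gcd_dvd_left (j - i * p) (p ^ 2 - 1)
    have hr := Int.gcd_dvd_right (j - i * p) (p ^ 2 - 1)
    refine Int.dvd_coe_gcd (Int.dvd_coe_gcd hl ?_) hr
    have := dvd_add (hl.mul_left (p + 1)) (hr.mul_left i)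
    rwa [show (p + 1) * (j - i * p) + i * (p ^ 2 - 1) = (p + 1) * (j - i) by ring] at this

theorem theorem3p10 (p : ℕ) (hp : p.Prime) (hp3 : 3 ≤ p) (i j : ℕ) (hi : 0 < i) (hj : 0 < j) :
    (i, j, 1, 1) ∈ setA (ZMod p) ↔
      (nu2 ((j : ℤ) - i) > nu2 ((p : ℤ) - 1) ∧ nu2 ((p : ℤ) - 1) ≥ nu2 ((i : ℤ) + j)) ∨
      (nu2 ((j : ℤ) - i) = nu2 ((p : ℤ) - 1) ∧ nu2 ((p : ℤ) - 1) ≠ nu2 ((i : ℤ) + j)) ∨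
      (nu2 ((j : ℤ) - i) < nu2 ((p : ℤ) - 1) ∧
        ¬ IsOddMultiple (Int.gcd ((j : ℤ) - i) ((p : ℤ) - 1))
            (Int.gcd ((j : ℤ) + i) ((p : ℤ) - 1))) ∨
      (nu2 ((j : ℤ) - i) < nu2 ((p : ℤ) - 1) ∧ p ∣ i + j ∧ ¬ p ∣ i) ∨
      (nu2 ((j : ℤ) - i * p) <
          nu2 ((p : ℤ) + 1) + min (nu2 ((j : ℤ) - i)) (nu2 ((p : ℤ) - 1)) ∧
        ¬ IsOddMultiple ((j : ℤ) - i)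
            (Int.gcd (Int.gcd ((j : ℤ) - i * p) (((p : ℤ) + 1) * ((j : ℤ) - i)))
              ((p : ℤ) ^ 2 - 1))) := by
  have : Fact p.Prime := ⟨hp⟩
  have hp2 : p ≠ 2 := by lia
  obtain ⟨m, hm⟩ := hp.odd_of_ne_two hp2
  have hm0 : 0 < m := by lia
  have hc2 : p ^ 2 = 2 * (2 * m * (m + 1)) + 1 := by rw [hm]; ring
  have hK : Nat.card (GaloisField p 2) = p ^ 2 := GaloisField.card p 2 two_ne_zero
  rw [mem_setA_one_one_iff hi hj, exists_matrix_iff_exists_lucasBalanced,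
    exists_lucasBalanced_zmod_iff hp2 hK hi hj,
    exists_pow_eq_neg_pow_pair_iff hm0 (by rw [Nat.card_zmod, hm]) hi hj,
    exists_pow_eq_neg_conj_pow_iff (h := 2 * m * (m + 1)) (by positivity) ⟨m, hm⟩ hc2
      (by rw [hK, hc2]),
    nu2_lt_add_min_iff (by exact_mod_cast hp.odd_of_ne_two hp2), gcd_gcd_eq,
    hasSplitExponents_iff_nu2 (by exact_mod_cast hm0)]
  have e1 : (2 * (m : ℤ)) = p - 1 := by rw [hm]; push_cast; ring
  have e2 : (2 * ((2 * m * (m + 1) : ℕ) : ℤ)) = p ^ 2 - 1 := by rw [hm]; push_cast; ring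
  have h4 : (∃ a : ZMod p, a ≠ 0 ∧ ((i + j : ℕ) : ZMod p) = 0 ∧ (i : ZMod p) ≠ 0 ∧ a ^ i = -a ^ j) ↔
      nu2 ((j : ℤ) - i) < nu2 ((p : ℤ) - 1) ∧ p ∣ i + j ∧ ¬ p ∣ i := by
    rw [← e1, ← exists_ne_zero_pow_eq_neg_pow_iff (F := ZMod p) hm0 (by rw [Nat.card_zmod, hm]),
      Ne, ZMod.natCast_eq_zero_iff, ZMod.natCast_eq_zero_iff]
    constructor
    · rintro ⟨a, h1, h2, h3, h4⟩
      exact ⟨⟨a, h1, h4⟩, h2, h3⟩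
    · rintro ⟨⟨a, h1, h4⟩, h2, h3⟩
      exact ⟨a, h1, h2, h3, h4⟩
  rw [h4, e1, e2]
  simp only [or_assoc]
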